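/- Let $(M^3,g)$ be a smooth Riemannian $3$-manifold, let $\Sigma$ be a compact smooth surface without boundary, and let $F:\Sigma\times[0,T]\to M$ be a smooth solution of inverse mean curvature flow by embeddings: $F$ is smooth, each $F_t=F(\cdot,t)$ is a smooth embedding, and $$\frac{\partial F}{\partial t}(p,t)=\frac{\nu(p,t)}{H(p,t)}\qquad\text{on }\Sigma\times[0,T),$$ where $\nu(\cdot,t)$ is a unit normal of $\Sigma_t=F_t(\Sigma)$, $A$ is the second fundamental form of $\Sigma_t$, $A(X,Y)=g(\nabla_X\nu,Y)$, and $H=\operatorname{tr}A$ is the mean curvature. Let $g_t=F_t^*g$ be the metric of $\Sigma_t$, and let $L^t$ and $|\cdot|_t$ be length and area with respect to $g_t$. Suppose that there are constants $H_0>0$ and $A_0<\infty$ such that $H(p,t)\ge H_0$ and $|A|(p,t)\le A_0$ for all $(p,t)\in\Sigma\times[0,T]$. 1. For every smooth curve $\gamma:[a,b]\to\Sigma$ (in particular for every smooth simple closed curve) and every $t\in[0,T]$, $$L^0(\gamma)\,e^{-\frac{2A_0}{H_0}t}\le L^t(\gamma)\le L^0(\gamma)\,e^{\frac{2A_0}{H_0}t}.$$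 2. For $\alpha>0$ let $$IN_\alpha(\Sigma_t)=\inf\ \frac{L^t(\gamma)}{\min\{|S_1|_t,|S_2|_t\}^{1/\alpha}},$$ where the infimum is over all $\gamma\subset\Sigma$ that are finite disjoint unions of smooth simple closed curves and separate $\Sigma$ into two pieces, that is, $\Sigma=S_1\cup\gamma\cup S_2$ is a disjoint union with $S_1,S_2$ nonempty and open and $\partial S_1=\gamma=\partial S_2$. Then for every $\alpha>0$ and every $t\in[0,T]$, $$IN_\alpha(\Sigma_0)\,e^{\left(-\frac{2A_0}{H_0}-\frac1\alpha\right)t}\le IN_\alpha(\Sigma_t)\le IN_\alpha(\Sigma_0)\,e^{\left(\frac{2A_0}{H_0}-\frac1\alpha\right)t}.$$ The same two inequalities hold for the variant of $IN_\alpha$ in which $\gamma$ is required to be a single smooth simple closed curve. -/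

import Mathlib

open Set MeasureTheory Manifold
open scoped ENNReal ContDiff

noncomputable section

namespace IMCF

/-- The model space of surfaces. -/
abbrev E2 : Type := EuclideanSpace ℝ (Fin 2)

/-- The model space of three-manifolds. -/
abbrev E3 : Type := EuclideanSpace ℝ (Fin 3)

/-- A smooth Riemannian metric on the three-manifold `M`. -/
abbrev Metric3 (M : Type*) [TopologicalSpace M] [ChartedSpace E3 M] [IsManifold 𝓘(ℝ, E3) ∞ M] :=
  Bundle.ContMDiffRiemannianMetric 𝓘(ℝ, E3) ∞ E3 (fun x : M => TangentSpace 𝓘(ℝ, E3) x)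

section Surface

/-! ### Length, area and isoperimetric constants of a surface with a metric `h` -/

variable {S : Type*} [TopologicalSpace S] [ChartedSpace E2 S]

/-- A real-valued pairing on each tangent space of a surface; below it is always the Riemannian
metric induced by an immersion. -/
abbrev FormField (S : Type*) [TopologicalSpace S] [ChartedSpace E2 S] :=
  ∀ p : S, TangentSpace 𝓘(ℝ, E2) p → TangentSpace 𝓘(ℝ, E2) p → ℝ

/-- The length `∫ √(h(γ', γ')) ds` over `[a, b]` of the curve `γ`. -/
def curveLength (h : FormField S) (γ : ℝ → S) (a b : ℝ) : ℝ≥0∞ :=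
  ∫⁻ s in Icc a b, ENNReal.ofReal (√(h (γ s)
    (mfderiv 𝓘(ℝ, ℝ) 𝓘(ℝ, E2) γ s (1 : ℝ)) (mfderiv 𝓘(ℝ, ℝ) 𝓘(ℝ, E2) γ s (1 : ℝ))))

/-- The coordinate vector field `∂ᵢ` of the chart around `x`, at the point with coordinates `y`. -/
def coordVec (x : S) (y : E2) (i : Fin 2) :
    TangentSpace 𝓘(ℝ, E2) ((extChartAt 𝓘(ℝ, E2) x).symm y) :=
  mfderiv 𝓘(ℝ, E2) 𝓘(ℝ, E2) (extChartAt 𝓘(ℝ, E2) x).symm y (EuclideanSpace.single i (1 : ℝ) : E2)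

/-- The matrix `hᵢⱼ = h(∂ᵢ, ∂ⱼ)` in the chart around `x`, at the point with coordinates `y`. -/
def gram (h : FormField S) (x : S) (y : E2) : Matrix (Fin 2) (Fin 2) ℝ :=
  Matrix.of fun i j => h ((extChartAt 𝓘(ℝ, E2) x).symm y) (coordVec x y i) (coordVec x y j)

/-- The area measure `√(det hᵢⱼ) dy¹ dy²` on the domain of the chart around `x`
(and zero outside this domain). -/
def chartArea [MeasurableSpace S] (h : FormField S) (x : S) : Measure S :=
  Measure.map (extChartAt 𝓘(ℝ, E2) x).symm
    ((volume.restrict (extChartAt 𝓘(ℝ, E2) x).target).withDensity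
      fun y => ENNReal.ofReal (√(gram h x y).det))

/-- The Riemannian area measure. For a Riemannian metric the measures `chartArea h x` agree on
overlaps of chart domains, and (on a second countable surface) their supremum in the complete
lattice of measures is the one measure that restricts to `chartArea h x` on the domain of each
chart. -/
def area [MeasurableSpace S] (h : FormField S) : Measure S := ⨆ x : S, chartArea h x

/-- A smooth (regular) simple closed curve, parametrized with period `1`. -/
structure IsSimpleClosedCurve (γ : ℝ → S) : Prop where
  smooth : ContMDiff 𝓘(ℝ, ℝ) 𝓘(ℝ, E2) ∞ γ
  periodic : Function.Periodic γ 1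
  simple : InjOn γ (Ico 0 1)
  regular : ∀ s, mfderiv 𝓘(ℝ, ℝ) 𝓘(ℝ, E2) γ s (1 : ℝ) ≠ 0

/-- The disjoint smooth simple closed curves `γ 0, …, γ (k-1)` separate the surface into the two
pieces `S₁` and `S₂`: the surface is the disjoint union of `S₁`, `S₂` and the curves, and
`∂S₁` and `∂S₂` are both the union of the curves. -/
structure Separates {k : ℕ} (γ : Fin k → ℝ → S) (S₁ S₂ : Set S) : Prop where
  curve : ∀ i, IsSimpleClosedCurve (γ i)
  disjoint_curves : Pairwise fun i j => Disjoint (range (γ i)) (range (γ j))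
  isOpen₁ : IsOpen S₁
  isOpen₂ : IsOpen S₂
  nonempty₁ : S₁.Nonempty
  nonempty₂ : S₂.Nonempty
  disjoint : Disjoint S₁ S₂
  cover : S₁ ∪ (⋃ i, range (γ i)) ∪ S₂ = univ
  frontier₁ : frontier S₁ = ⋃ i, range (γ i)
  frontier₂ : frontier S₂ = ⋃ i, range (γ i)

/-- The infimum of `L(γ) / min(|S₁|, |S₂|)^(1/α)` over all `γ` with exactly `k` components. -/
def isoperimetricInf [MeasurableSpace S] (k : ℕ) (α : ℝ) (h : FormField S) : ℝ≥0∞ :=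
  ⨅ (γ : Fin k → ℝ → S) (S₁ : Set S) (S₂ : Set S) (_ : Separates γ S₁ S₂),
    (∑ i, curveLength h (γ i) 0 1) / (min (area h S₁) (area h S₂)) ^ (1 / α)

/-- The Neumann `α`-isoperimetric constant
`IN_α = inf L(γ) / min(|S₁|, |S₂|)^(1/α)`, the infimum over all closed smooth embedded
one-dimensional submanifolds `γ` that separate the surface into two pieces `S₁`, `S₂`. -/
def neumannIsoperimetric [MeasurableSpace S] (α : ℝ) (h : FormField S) : ℝ≥0∞ :=
  ⨅ k : ℕ, isoperimetricInf k α h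

/-- The variant of the Neumann `α`-isoperimetric constant where the separating `γ` is a single
smooth simple closed curve. -/
def neumannIsoperimetricConn [MeasurableSpace S] (α : ℝ) (h : FormField S) : ℝ≥0∞ :=
  isoperimetricInf 1 α h

end Surface

section Hypersurface

/-! ### Surfaces in a Riemannian three-manifold -/

variable {M : Type*} [TopologicalSpace M] [ChartedSpace E3 M] [IsManifold 𝓘(ℝ, E3) ∞ M]
  {S : Type*} [TopologicalSpace S] [ChartedSpace E2 S]

/-- The metric on `S` induced by `f : S → M`. -/
def inducedMetric (g : Metric3 M) (f : S → M) : FormField S := fun p X Y =>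
  g.inner (f p) (mfderiv 𝓘(ℝ, E2) 𝓘(ℝ, E3) f p X) (mfderiv 𝓘(ℝ, E2) 𝓘(ℝ, E3) f p Y)

/-- `n` is a unit normal vector of the immersed surface `f` at the point `f p`. -/
structure IsUnitNormal (g : Metric3 M) (f : S → M) (p : S)
    (n : TangentSpace 𝓘(ℝ, E3) (f p)) : Prop where
  unit : g.inner (f p) n n = 1
  orthogonal : ∀ X : TangentSpace 𝓘(ℝ, E2) p,
    g.inner (f p) n (mfderiv 𝓘(ℝ, E2) 𝓘(ℝ, E3) f p X) = 0

/-- The coefficients `G_y(a, b) = ∑ gₖₗ(y) aᵏ bˡ` of the metric in the chart of `M` around `q`. -/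
def metricCoord (g : Metric3 M) (q : M) (y a b : E3) : ℝ :=
  g.inner ((extChartAt 𝓘(ℝ, E3) q).symm y)
    (mfderiv 𝓘(ℝ, E3) 𝓘(ℝ, E3) (extChartAt 𝓘(ℝ, E3) q).symm y a)
    (mfderiv 𝓘(ℝ, E3) 𝓘(ℝ, E3) (extChartAt 𝓘(ℝ, E3) q).symm y b)

/-- The Christoffel symbols of the first kind in the chart of `M` around `q`, as a trilinear form:
`Γ(a, b; c) = ½ (∂_a G(b, c) + ∂_b G(a, c) - ∂_c G(a, b))`, so that
`G(∇_a b, c) = Γ(a, b; c)` for constant coordinate vectors `a, b, c` and the Levi-Civita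
connection `∇`. -/
def christoffel (g : Metric3 M) (q : M) (y a b c : E3) : ℝ :=
  (1 / 2) * (fderiv ℝ (fun z => metricCoord g q z b c) y a
    + fderiv ℝ (fun z => metricCoord g q z a c) y b
    - fderiv ℝ (fun z => metricCoord g q z a b) y c)

/-- The second fundamental form `Aᵢⱼ = g(∇_{∂ᵢ} n, ∂ⱼ) = - g(n, ∇_{∂ᵢ} ∂ⱼ f)` of `f` at `p` with
respect to the unit normal `n`, in the chart of `S` around `p`. Here `u` is `f` in charts,
`N` the coordinate vector of `n`, and
`g(n, ∇_{∂ᵢ} ∂ⱼ f) = G(∂ᵢ∂ⱼ u, N) + Γ(∂ᵢ u, ∂ⱼ u; N)`. -/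
def secondFundamentalForm (g : Metric3 M) (f : S → M) (p : S)
    (n : TangentSpace 𝓘(ℝ, E3) (f p)) : Matrix (Fin 2) (Fin 2) ℝ :=
  let u : E2 → E3 := extChartAt 𝓘(ℝ, E3) (f p) ∘ f ∘ (extChartAt 𝓘(ℝ, E2) p).symm
  let x : E2 := extChartAt 𝓘(ℝ, E2) p p
  let N : E3 := mfderiv 𝓘(ℝ, E3) 𝓘(ℝ, E3) (extChartAt 𝓘(ℝ, E3) (f p)) (f p) n
  let e : Fin 2 → E2 := fun i => EuclideanSpace.single i (1 : ℝ)
  Matrix.of fun i j =>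
    -(metricCoord g (f p) (u x) (fderiv ℝ (fderiv ℝ u) x (e i) (e j)) N
      + christoffel g (f p) (u x) (fderiv ℝ u x (e i)) (fderiv ℝ u x (e j)) N)

/-- The matrix `gᵢⱼ` of the induced metric at `p` in the chart of `S` around `p`. -/
def firstFundamentalForm (g : Metric3 M) (f : S → M) (p : S) : Matrix (Fin 2) (Fin 2) ℝ :=
  gram (inducedMetric g f) p (extChartAt 𝓘(ℝ, E2) p p)

/-- The mean curvature `H = gⁱʲ Aᵢⱼ`, the sum of the principal curvatures. -/
def meanCurvature (g : Metric3 M) (f : S → M) (p : S)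
    (n : TangentSpace 𝓘(ℝ, E3) (f p)) : ℝ :=
  ((firstFundamentalForm g f p)⁻¹ * secondFundamentalForm g f p n).trace

/-- The norm `|A| = √(gⁱʲ gᵏˡ Aᵢₖ Aⱼₗ)` of the second fundamental form. -/
def normA (g : Metric3 M) (f : S → M) (p : S)
    (n : TangentSpace 𝓘(ℝ, E3) (f p)) : ℝ :=
  √(((firstFundamentalForm g f p)⁻¹ * secondFundamentalForm g f p n *
    ((firstFundamentalForm g f p)⁻¹ * secondFundamentalForm g f p n)).trace)

/-- A smooth solution `F : S × [0, T] → M` of inverse mean curvature flow `∂F/∂t = ν / H` by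
embeddings, with unit normal `ν`. As `ν / H` does not change when `ν` is replaced by `-ν`, the
equation does not depend on the side to which `ν` points. The values of `F` and `ν` at times
outside `[0, T]` play no role. -/
structure IsSolution (g : Metric3 M) (T : ℝ) (F : ℝ → S → M)
    (ν : ∀ (t : ℝ) (p : S), TangentSpace 𝓘(ℝ, E3) (F t p)) : Prop where
  smooth : ContMDiffOn (𝓘(ℝ, ℝ).prod 𝓘(ℝ, E2)) 𝓘(ℝ, E3) ∞
    (fun z : ℝ × S => F z.1 z.2) (Icc 0 T ×ˢ univ)
  embedding : ∀ t ∈ Icc 0 T, IsSmoothEmbedding 𝓘(ℝ, E2) 𝓘(ℝ, E3) ∞ (F t)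
  normal : ∀ t ∈ Icc 0 T, ∀ p, IsUnitNormal g (F t) p (ν t p)
  meanCurvature_ne_zero : ∀ t ∈ Ico 0 T, ∀ p, meanCurvature g (F t) p (ν t p) ≠ 0
  flow : ∀ t ∈ Ico 0 T, ∀ p,
    mfderivWithin 𝓘(ℝ, ℝ) 𝓘(ℝ, E3) (fun s => F s p) (Icc 0 T) t (1 : ℝ)
      = (meanCurvature g (F t) p (ν t p))⁻¹ • ν t p

end Hypersurface

end IMCF

end

/-!
Let `h_t = F_t^* g` be the induced metric. The whole theorem rests on the variation formula
`∂_t h_t(X, Y) = 2 A(X, Y) / H` (`hasDerivAt_firstFundamentalForm`).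

It is proved in charts, where the flow is a map `U(s, y)` and the metric of `M` is a field of
bilinear forms `G`. Differentiating `G(∂_i U, ∂_j U)` in time produces the terms
`G(∂_t ∂_i U, ∂_j U)`. The velocity `W = ∂_t U` is normal to the surface, so `G(W, ∂_j U) = 0`;
differentiating this identity along the surface and interchanging `∂_t` and `∂_i` turns these terms
into `-G(W, ∂_i ∂_j U)` and derivatives of `G`, which combine to the Christoffel symbols
(`hasDerivAt_inducedMetric_of_orthogonal`). Only the normality of the velocity near the point and
its value `ν / H` at the point are used; `ν` and `H` are never differentiated. The formula is needed
only at interior times, since the metric is continuous on `[0, T]`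
(`continuousOn_firstFundamentalForm`).

There are two consequences. First, `|A(X, X)| ≤ |A| h_t(X, X)` (`abs_quadraticForm_le`), so
`|∂_t h_t(X, X)| ≤ (2 A₀ / H₀) h_t(X, X)`, and Grönwall's inequality bounds `h_t(X, X)`, hence
lengths (`inducedMetric_self_bounds`, `curveLength_mul_exp_le`). Second, by Jacobi's formula
`∂_t det h_t = 2 (tr A / H) det h_t = 2 det h_t`, so the area measure is multiplied by exactly
`exp t` (`det_firstFundamentalForm_eq`, `area_eq_smul`). For each separating family of curves the
isoperimetric quotient is therefore multiplied by a factor within the stated bounds, and so is the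
infimum (`isoperimetricInf_mul_exp_le`).
-/

namespace IMCF

open Filter Topology

/-! ### Symmetric `2 × 2` matrices -/

/-- The quadratic form of a symmetric matrix `A` is bounded by the norm `√tr((h⁻¹ A)²)` of `A` with
respect to `h` times the quadratic form of the positive definite matrix `h`. -/
theorem abs_quadraticForm_le (h A : Matrix (Fin 2) (Fin 2) ℝ) (hs : h 0 1 = h 1 0)
    (As : A 0 1 = A 1 0) (h00 : 0 < h 0 0) (hdet : 0 < h.det) (x y : ℝ) :
    |A 0 0 * x ^ 2 + 2 * A 0 1 * (x * y) + A 1 1 * y ^ 2| ≤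
      √((h⁻¹ * A * (h⁻¹ * A)).trace) *
        (h 0 0 * x ^ 2 + 2 * h 0 1 * (x * y) + h 1 1 * y ^ 2) := by
  set a := h 0 0 with ha
  set b := h 0 1 with hb
  set c := h 1 1 with hc
  set p := A 0 0 with hp
  set q := A 0 1 with hq
  set r := A 1 1 with hr
  obtain ⟨D, hD⟩ : ∃ D, D = h.det := ⟨_, rfl⟩
  have hD' : D = a * c - b * b := by rw [hD, Matrix.det_fin_two, ← hs]
  rw [← hD] at hdet
  have hc' : c = (D + b * b) / a := by field_simp; linarith
  -- The numbers `m`, `n` are entries of `A` in the `h`-orthogonal basis `e₀, a e₁ - b e₀`.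
  obtain ⟨m, hm⟩ : ∃ m, m = a * q - b * p := ⟨_, rfl⟩
  obtain ⟨n, hn⟩ : ∃ n, n = a ^ 2 * r - 2 * a * b * q + b ^ 2 * p := ⟨_, rfl⟩
  have htr : (h⁻¹ * A * (h⁻¹ * A)).trace =
      p ^ 2 / a ^ 2 + 2 * m ^ 2 / (a ^ 2 * D) + n ^ 2 / (a * D) ^ 2 := by
    rw [Matrix.inv_def, Ring.inverse_eq_inv', ← hD, Matrix.adjugate_fin_two]
    simp only [Matrix.trace_fin_two, Matrix.mul_apply, Fin.sum_univ_two, Matrix.smul_apply,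
      Matrix.of_apply, Matrix.cons_val', Matrix.cons_val_zero, Matrix.cons_val_one, smul_eq_mul,
      Matrix.cons_val_fin_one, ← hs, ← As, ← ha, ← hb, ← hc, ← hp, ← hq, ← hr]
    rw [hc', hm, hn]
    field_simp
    ring
  obtain ⟨ξ, hξ⟩ : ∃ ξ, ξ = x + b * y / a := ⟨_, rfl⟩
  obtain ⟨η, hη⟩ : ∃ η, η = y / a := ⟨_, rfl⟩
  have hquad : a * x ^ 2 + 2 * b * (x * y) + c * y ^ 2 = a * ξ ^ 2 + a * D * η ^ 2 := by
    rw [hc', hξ, hη]; field_simp; ring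
  have hquadA : p * x ^ 2 + 2 * q * (x * y) + r * y ^ 2 =
      p * ξ ^ 2 + 2 * m * (ξ * η) + n * η ^ 2 := by
    rw [hξ, hη, hm, hn]; field_simp; ring
  rw [htr, hquad, hquadA]
  refine abs_le_of_sq_le_sq ?_ (by positivity)
  rw [mul_pow, Real.sq_sqrt (by positivity), ← sub_nonneg]
  -- Lagrange's identity for the Cauchy-Schwarz inequality
  have hlag : (p ^ 2 / a ^ 2 + 2 * m ^ 2 / (a ^ 2 * D) + n ^ 2 / (a * D) ^ 2) *
      (a * ξ ^ 2 + a * D * η ^ 2) ^ 2 - (p * ξ ^ 2 + 2 * m * (ξ * η) + n * η ^ 2) ^ 2 =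
      (p * D * η ^ 2 - n / D * ξ ^ 2) ^ 2 + 2 * ξ ^ 2 / D * (p * D * η - m * ξ) ^ 2 +
        2 * D * η ^ 2 * (n / D * ξ - m * η) ^ 2 := by
    field_simp
    ring
  rw [hlag]
  positivity

/-- Jacobi's formula for `2 × 2` matrices. -/
theorem hasDerivAt_det_fin_two {h : ℝ → Matrix (Fin 2) (Fin 2) ℝ} {A : Matrix (Fin 2) (Fin 2) ℝ}
    {t c : ℝ} (hdet : (h t).det ≠ 0)
    (hd : ∀ i j, HasDerivAt (fun s => h s i j) (c * A i j) t) :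
    HasDerivAt (fun s => (h s).det) (c * ((h t)⁻¹ * A).trace * (h t).det) t := by
  have htr : ((h t)⁻¹ * A).trace * (h t).det = ((h t).adjugate * A).trace := by
    rw [Matrix.inv_def, Ring.inverse_eq_inv', Matrix.smul_mul, Matrix.trace_smul, smul_eq_mul]
    field_simp
  rw [mul_assoc, htr]
  simp only [Matrix.det_fin_two, Matrix.adjugate_fin_two, Matrix.trace_fin_two,
    Matrix.mul_apply, Fin.sum_univ_two]
  refine (((hd 0 0).mul (hd 1 1)).sub ((hd 0 1).mul (hd 1 0))).congr_deriv ?_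
  simp only [Matrix.of_apply, Matrix.cons_val', Matrix.cons_val_zero, Matrix.cons_val_one,
    Matrix.cons_val_fin_one]
  ring

/-! ### The variation formula in coordinates -/

/-- The variation formula in coordinates: if the velocity `W = ∂_t U` is orthogonal to the image of
`U(t, ·)` with respect to the metric `G`, then `∂_t G(∂_a U, ∂_b U) = -2 G(∇_a ∂_b U, W)`. The
derivatives of `G` on the right-hand side are the Christoffel symbol `Γ(∂_a U, ∂_b U; W)`. -/
theorem hasDerivAt_inducedMetric_of_orthogonal {V E : Type*} [NormedAddCommGroup V]
    [NormedSpace ℝ V] [NormedAddCommGroup E] [NormedSpace ℝ E] {U : ℝ × V → E}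
    {G : E → E →L[ℝ] E →L[ℝ] ℝ} {t : ℝ} {x : V} (hU : ContDiffAt ℝ 2 U (t, x))
    (hG : DifferentiableAt ℝ G (U (t, x))) (hsymm : ∀ y v w, G y v w = G y w v)
    (horth : ∀ᶠ y in 𝓝 x, ∀ b,
      G (U (t, y)) (fderiv ℝ U (t, y) (1, 0)) (fderiv ℝ U (t, y) (0, b)) = 0) (a b : V) :
    HasDerivAt (fun s => G (U (s, x)) (fderiv ℝ U (s, x) (0, a)) (fderiv ℝ U (s, x) (0, b)))
      (-2 * (G (U (t, x)) (fderiv ℝ (fderiv ℝ U) (t, x) (0, a) (0, b))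
          (fderiv ℝ U (t, x) (1, 0)) +
        1 / 2 * (
          fderiv ℝ G (U (t, x)) (fderiv ℝ U (t, x) (0, a)) (fderiv ℝ U (t, x) (0, b))
            (fderiv ℝ U (t, x) (1, 0)) +
          fderiv ℝ G (U (t, x)) (fderiv ℝ U (t, x) (0, b)) (fderiv ℝ U (t, x) (0, a))
            (fderiv ℝ U (t, x) (1, 0)) -
          fderiv ℝ G (U (t, x)) (fderiv ℝ U (t, x) (1, 0)) (fderiv ℝ U (t, x) (0, a))
            (fderiv ℝ U (t, x) (0, b))))) t := by
  obtain ⟨K, hK⟩ : ∃ K, K = fderiv ℝ U := ⟨_, rfl⟩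
  have hU1 : HasFDerivAt U (K (t, x)) (t, x) := by
    rw [hK]; exact (hU.differentiableAt (by norm_num)).hasFDerivAt
  have hU2 : HasFDerivAt K (fderiv ℝ K (t, x)) (t, x) := by
    rw [hK]
    exact ((hU.fderiv_right (m := 1) (by norm_num)).differentiableAt (by norm_num)).hasFDerivAt
  have hsym2 : ∀ v w, fderiv ℝ K (t, x) v w = fderiv ℝ K (t, x) w v := by
    rw [hK]; exact hU.isSymmSndFDerivAt (by simp)
  have hG1 : HasFDerivAt (fun z => G (U z)) _ (t, x) :=
    HasFDerivAt.comp (g := G) (f := U) (t, x) hG.hasFDerivAt hU1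
  have hGsym : ∀ u v w, fderiv ℝ G (U (t, x)) u v w = fderiv ℝ G (U (t, x)) u w v := by
    intro u v w
    have h1 := (hG.hasFDerivAt.clm_apply (hasFDerivAt_const v _)).clm_apply (hasFDerivAt_const w _)
    have h2 := (hG.hasFDerivAt.clm_apply (hasFDerivAt_const w _)).clm_apply (hasFDerivAt_const v _)
    have h3 := h1.unique (h2.congr_of_eventuallyEq (.of_forall fun y => hsymm y v w))
    simpa using congr($h3 u)
  rw [← hK] at horth ⊢
  -- the derivative of `G(∂_v U, ∂_w U)` for constant vectors `v, w`
  have key : ∀ v w : ℝ × V, HasFDerivAt (fun z => G (U z) (K z v) (K z w)) _ (t, x) := fun v w =>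
    (hG1.clm_apply (hU2.clm_apply (hasFDerivAt_const v _))).clm_apply
      (hU2.clm_apply (hasFDerivAt_const w _))
  have hs : HasDerivAt (fun s : ℝ => (s, x)) ((1 : ℝ), (0 : V)) t :=
    (hasDerivAt_id t).prodMk (hasDerivAt_const t x)
  have hy : HasFDerivAt (fun y : V => (t, y)) (ContinuousLinearMap.inr ℝ ℝ V) x :=
    hasFDerivAt_prodMk_right t x
  have ht := (key (0, a) (0, b)).comp_hasDerivAt t hs
  -- the derivative of `G(W, ∂_b U) = 0` in the direction of `c`
  have horth' : ∀ b c : V, _ := fun b c => by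
    have h1 := (key (1, 0) (0, b)).comp x hy
    have h2 := h1.unique ((hasFDerivAt_const (0 : ℝ) x).congr_of_eventuallyEq
      (horth.mono fun y h => h b))
    simpa using! congr($h2 c)
  refine ht.congr_deriv ?_
  have h1 := horth' b a
  have h2 := horth' a b
  simp [hsym2 (1, 0), hsym2 (0, b) (0, a)] at h1 h2 ⊢
  rw [hsymm _ (K (t, x) (1, 0))] at h1 h2
  rw [hsymm _ (K (t, x) (0, a))]
  rw [hGsym _ _ (K (t, x) (1, 0)), hGsym _ _ (K (t, x) (1, 0))]
  linarith

/-! ### The metric of the three-manifold in a chart -/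

section MetricCoord

variable {M : Type*} [TopologicalSpace M] [ChartedSpace E3 M] [IsManifold 𝓘(ℝ, E3) ∞ M]

/-- The metric in the chart around `q`, as a field of bilinear forms on `E3`: `metricCoord` with its
bilinearity and continuity bundled, so that it can be differentiated as a map of the base point. -/
noncomputable def metricCoordCLM (g : Metric3 M) (q : M) (y : E3) : E3 →L[ℝ] E3 →L[ℝ] ℝ :=
  let L : E3 →L[ℝ] E3 := mfderiv 𝓘(ℝ, E3) 𝓘(ℝ, E3) (extChartAt 𝓘(ℝ, E3) q).symm y
  let B : E3 →L[ℝ] E3 →L[ℝ] ℝ := g.inner ((extChartAt 𝓘(ℝ, E3) q).symm y)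
  B.bilinearComp L L

theorem metricCoordCLM_apply (g : Metric3 M) (q : M) (y a b : E3) :
    metricCoordCLM g q y a b = metricCoord g q y a b := rfl

theorem metricCoordCLM_symm (g : Metric3 M) (q : M) (y a b : E3) :
    metricCoordCLM g q y a b = metricCoordCLM g q y b a := g.symm _ _ _

/-- Smoothness in coordinates of the metric, which is given as a smooth section of a bundle: its
coefficients are its values on the coordinate vector fields, which are smooth sections too. -/
theorem contDiffOn_metricCoordCLM (g : Metric3 M) (q : M) :
    ContDiffOn ℝ 1 (metricCoordCLM g q) (extChartAt 𝓘(ℝ, E3) q).target := by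
  refine contDiffOn_clm_apply.2 fun a => contDiffOn_clm_apply.2 fun b => ?_
  rw [← contMDiffOn_iff_contDiffOn]
  have hsymm : ContMDiffOn 𝓘(ℝ, E3) 𝓘(ℝ, E3) ∞ (extChartAt 𝓘(ℝ, E3) q).symm
      (extChartAt 𝓘(ℝ, E3) q).target := contMDiffOn_extChartAt_symm q
  have hopen : IsOpen (extChartAt 𝓘(ℝ, E3) q).target := isOpen_extChartAt_target q
  -- the coordinate vector fields, as restrictions of the tangent map of the inverse chart
  have hvec : ∀ a : E3, ContMDiffOn 𝓘(ℝ, E3) (𝓘(ℝ, E3).prod 𝓘(ℝ, E3)) 1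
      (fun y => Bundle.TotalSpace.mk' E3 (E := fun x : M => TangentSpace 𝓘(ℝ, E3) x)
        ((extChartAt 𝓘(ℝ, E3) q).symm y)
        (mfderiv 𝓘(ℝ, E3) 𝓘(ℝ, E3) (extChartAt 𝓘(ℝ, E3) q).symm y a))
      (extChartAt 𝓘(ℝ, E3) q).target := by
    intro a
    have h1 := hsymm.contMDiffOn_tangentMapWithin (m := 1)
      (by norm_num; exact WithTop.coe_le_coe.2 (le_top (a := (2 : ℕ∞))))
      hopen.uniqueMDiffOn
    have h2 : ContMDiff 𝓘(ℝ, E3) (𝓘(ℝ, E3).prod 𝓘(ℝ, E3)) 1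
        (fun y : E3 => Bundle.TotalSpace.mk' E3 (E := fun x : E3 => TangentSpace 𝓘(ℝ, E3) x)
          y a) := by
      intro y
      rw [Bundle.contMDiffAt_totalSpace]
      exact ⟨contMDiffAt_id, by simpa using! contMDiffAt_const⟩
    refine (h1.comp h2.contMDiffOn fun y hy => hy).congr fun y hy => ?_
    simp only [tangentMapWithin, Function.comp]
    rw [mfderivWithin_of_isOpen hopen hy]
  intro y hy
  have hinner : ContMDiffWithinAt 𝓘(ℝ, E3) (𝓘(ℝ, E3).prod 𝓘(ℝ, E3 →L[ℝ] E3 →L[ℝ] ℝ)) 1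
      (fun y => Bundle.TotalSpace.mk' (E3 →L[ℝ] E3 →L[ℝ] ℝ)
        (E := fun x : M => TangentSpace 𝓘(ℝ, E3) x →L[ℝ] TangentSpace 𝓘(ℝ, E3) x →L[ℝ] ℝ)
        ((extChartAt 𝓘(ℝ, E3) q).symm y) (g.inner ((extChartAt 𝓘(ℝ, E3) q).symm y)))
      (extChartAt 𝓘(ℝ, E3) q).target y :=
    ((g.contMDiff.of_le (by norm_num)).contMDiffAt).comp_contMDiffWithinAt y
      ((hsymm y hy).of_le (by norm_num))
  have h3 : ContMDiffWithinAt 𝓘(ℝ, E3) (𝓘(ℝ, E3).prod 𝓘(ℝ, ℝ)) 1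
      (fun y => Bundle.TotalSpace.mk' ℝ (E := Bundle.Trivial M ℝ)
        ((extChartAt 𝓘(ℝ, E3) q).symm y) (metricCoord g q y a b))
      (extChartAt 𝓘(ℝ, E3) q).target y := by
    apply ContMDiffWithinAt.clm_bundle_apply₂ (F₁ := E3) (F₂ := E3)
    · exact hinner
    · exact hvec a y hy
    · exact hvec b y hy
  rw [Bundle.contMDiffWithinAt_totalSpace] at h3
  exact h3.2

theorem differentiableAt_metricCoordCLM (g : Metric3 M) (q : M) {y : E3}
    (hy : y ∈ (extChartAt 𝓘(ℝ, E3) q).target) : DifferentiableAt ℝ (metricCoordCLM g q) y :=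
  ((contDiffOn_metricCoordCLM g q).contDiffAt
    ((isOpen_extChartAt_target q).mem_nhds hy)).differentiableAt one_ne_zero

theorem christoffel_eq (g : Metric3 M) (q : M) {y : E3}
    (hy : y ∈ (extChartAt 𝓘(ℝ, E3) q).target) (a b c : E3) :
    christoffel g q y a b c = 1 / 2 * (fderiv ℝ (metricCoordCLM g q) y a b c +
      fderiv ℝ (metricCoordCLM g q) y b a c - fderiv ℝ (metricCoordCLM g q) y c a b) := by
  have h : ∀ u v w : E3, fderiv ℝ (fun z => metricCoord g q z v w) y u =
      fderiv ℝ (metricCoordCLM g q) y u v w := fun u v w => by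
    have h1 := ((differentiableAt_metricCoordCLM g q hy).hasFDerivAt.clm_apply
      (hasFDerivAt_const v _)).clm_apply (hasFDerivAt_const w _)
    simpa [metricCoordCLM_apply] using congr($(h1.fderiv) u)
  rw [christoffel, h, h, h]

end MetricCoord

/-! ### Tangent vectors and the induced metric in charts -/

section Charts

variable {M : Type*} [TopologicalSpace M] [ChartedSpace E3 M] [IsManifold 𝓘(ℝ, E3) ∞ M]

theorem mdifferentiableAt_extChartAt_symm_of_mem (q : M) {y : E3}
    (hy : y ∈ (extChartAt 𝓘(ℝ, E3) q).target) :
    MDifferentiableAt 𝓘(ℝ, E3) 𝓘(ℝ, E3) (extChartAt 𝓘(ℝ, E3) q).symm y := by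
  have : IsManifold 𝓘(ℝ, E3) 1 M := .of_le (n := ∞) (by norm_num)
  exact ((mdifferentiableOn_extChartAt_symm (I := 𝓘(ℝ, E3)) (x := q)) y hy).mdifferentiableAt
    ((isOpen_extChartAt_target q).mem_nhds hy)

theorem mdifferentiableAt_extChartAt_of_mem (q : M) {m : M}
    (hm : m ∈ (extChartAt 𝓘(ℝ, E3) q).source) :
    MDifferentiableAt 𝓘(ℝ, E3) 𝓘(ℝ, E3) (extChartAt 𝓘(ℝ, E3) q) m := by
  have : IsManifold 𝓘(ℝ, E3) 1 M := .of_le (n := ∞) (by norm_num)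
  exact mdifferentiableAt_extChartAt (by simpa using hm)

/-- The derivative of a map into `M` is the coordinate derivative transported by the inverse
chart. -/
theorem mfderiv_eq_mfderiv_extChartAt_symm {V : Type*} [NormedAddCommGroup V] [NormedSpace ℝ V]
    (q : M) {φ : V → M} {y : V} (hφ : MDifferentiableAt 𝓘(ℝ, V) 𝓘(ℝ, E3) φ y)
    (hy : φ y ∈ (extChartAt 𝓘(ℝ, E3) q).source) (a : V) :
    (mfderiv 𝓘(ℝ, V) 𝓘(ℝ, E3) φ y a : E3) =
      (mfderiv 𝓘(ℝ, E3) 𝓘(ℝ, E3) (extChartAt 𝓘(ℝ, E3) q).symm (extChartAt 𝓘(ℝ, E3) q (φ y)) :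
        E3 →L[ℝ] E3) (fderiv ℝ (extChartAt 𝓘(ℝ, E3) q ∘ φ) y a) := by
  -- the chain rule is applied to `φ = chart⁻¹ ∘ (chart ∘ φ)`
  have hev : φ =ᶠ[𝓝 y]
      (extChartAt 𝓘(ℝ, E3) q).symm ∘ (extChartAt 𝓘(ℝ, E3) q ∘ φ) := by
    filter_upwards [hφ.continuousAt.preimage_mem_nhds
      ((isOpen_extChartAt_source q).mem_nhds hy)] with z hz
    exact ((extChartAt 𝓘(ℝ, E3) q).left_inv hz).symm
  have hu : MDifferentiableAt 𝓘(ℝ, V) 𝓘(ℝ, E3) (extChartAt 𝓘(ℝ, E3) q ∘ φ) y :=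
    (mdifferentiableAt_extChartAt_of_mem q hy).comp y hφ
  have h1 := hev.mfderiv_eq (I := 𝓘(ℝ, V)) (I' := 𝓘(ℝ, E3))
  rw [mfderiv_comp (I' := 𝓘(ℝ, E3)) y (mdifferentiableAt_extChartAt_symm_of_mem q
    ((extChartAt 𝓘(ℝ, E3) q).map_source hy)) hu] at h1
  rw [h1, ← mfderiv_eq_fderiv]
  rfl

/-- The equation `m = m'` cannot be rewritten directly, as the type of `g.inner m` depends on `m`;
here all tangent spaces are identified with `E3`. -/
theorem inner_congr (g : Metric3 M) {m m' : M} (h : m = m') (v w : E3) :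
    (g.inner m : E3 →L[ℝ] E3 →L[ℝ] ℝ) v w = (g.inner m' : E3 →L[ℝ] E3 →L[ℝ] ℝ) v w := by
  subst h; rfl

theorem metricCoordCLM_extChartAt (g : Metric3 M) (q : M) {m : M}
    (hm : m ∈ (extChartAt 𝓘(ℝ, E3) q).source) (v w : E3) :
    metricCoordCLM g q (extChartAt 𝓘(ℝ, E3) q m) v w =
      (g.inner m : E3 →L[ℝ] E3 →L[ℝ] ℝ)
        ((mfderiv 𝓘(ℝ, E3) 𝓘(ℝ, E3) (extChartAt 𝓘(ℝ, E3) q).symm (extChartAt 𝓘(ℝ, E3) q m) :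
          E3 →L[ℝ] E3) v)
        ((mfderiv 𝓘(ℝ, E3) 𝓘(ℝ, E3) (extChartAt 𝓘(ℝ, E3) q).symm (extChartAt 𝓘(ℝ, E3) q m) :
          E3 →L[ℝ] E3) w) :=
  inner_congr g ((extChartAt 𝓘(ℝ, E3) q).left_inv hm) _ _

variable {S : Type*} [TopologicalSpace S] [ChartedSpace E2 S]

theorem inducedMetric_congr (g : Metric3 M) (f : S → M) {p p' : S} (h : p = p') (X Y : E2) :
    inducedMetric g f p X Y = inducedMetric g f p' X Y := by
  subst h; rfl

theorem firstFundamentalForm_symm (g : Metric3 M) (f : S → M) (p : S) (i j : Fin 2) :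
    firstFundamentalForm g f p i j = firstFundamentalForm g f p j i := g.symm _ _ _

theorem inducedMetric_self_nonneg (g : Metric3 M) (f : S → M) (p : S)
    (X : TangentSpace 𝓘(ℝ, E2) p) : 0 ≤ inducedMetric g f p X X := by
  by_cases h : mfderiv 𝓘(ℝ, E2) 𝓘(ℝ, E3) f p X = 0
  · simp [inducedMetric, h]
  · exact (g.pos _ _ h).le

variable [IsManifold 𝓘(ℝ, E2) ∞ S]

/-- At the base point of its chart, a coordinate vector is a standard basis vector, since the
tangent space is by definition the model space read in that chart. -/
theorem coordVec_self (p : S) (i : Fin 2) :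
    (coordVec p (extChartAt 𝓘(ℝ, E2) p p) i : E2) = EuclideanSpace.single i (1 : ℝ) := by
  have : IsManifold 𝓘(ℝ, E2) 1 S := .of_le (n := ∞) (by norm_num)
  have h := mfderivWithin_range_extChartAt_symm (I := 𝓘(ℝ, E2)) (x := p)
  rw [modelWithCornersSelf_coe, range_id, mfderivWithin_univ] at h
  exact congr($h (EuclideanSpace.single i (1 : ℝ) : E2))

/-- The first fundamental form is the matrix of the induced metric in the standard basis of the
tangent space, which is the coordinate basis of the chart around the base point. -/
theorem firstFundamentalForm_apply (g : Metric3 M) (f : S → M) (p : S) (i j : Fin 2) :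
    firstFundamentalForm g f p i j =
      inducedMetric g f p (EuclideanSpace.single i (1 : ℝ) : E2)
        (EuclideanSpace.single j (1 : ℝ) : E2) := by
  have h := inducedMetric_congr g f (extChartAt_to_inv (I := 𝓘(ℝ, E2)) p)
    (coordVec p (extChartAt 𝓘(ℝ, E2) p p) i) (coordVec p (extChartAt 𝓘(ℝ, E2) p p) j)
  rw [coordVec_self, coordVec_self] at h
  rw [← h]
  change inducedMetric g f _ (coordVec p (extChartAt 𝓘(ℝ, E2) p p) i : E2)
    (coordVec p (extChartAt 𝓘(ℝ, E2) p p) j : E2) = _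
  rw [coordVec_self, coordVec_self]

theorem inducedMetric_eq_sum (g : Metric3 M) (f : S → M) (p : S) (X Y : E2) :
    inducedMetric g f p X Y = ∑ i, ∑ j, X i * Y j * firstFundamentalForm g f p i j := by
  have hsum : ∀ Z : E2, Z = ∑ i, Z i • (EuclideanSpace.single i (1 : ℝ) : E2) := fun Z => by
    ext k; simp [Fin.sum_univ_two]; fin_cases k <;> simp
  let L : E2 →L[ℝ] E3 := mfderiv 𝓘(ℝ, E2) 𝓘(ℝ, E3) f p
  let B : E3 →L[ℝ] E3 →L[ℝ] ℝ := g.inner (f p)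
  have hB : ∀ X Y : E2, inducedMetric g f p X Y = B (L X) (L Y) := fun _ _ => rfl
  simp only [firstFundamentalForm_apply, hB]
  conv_lhs => rw [hsum X, hsum Y]
  simp only [Fin.sum_univ_two, map_add, map_smul, add_apply,
    smul_apply, smul_eq_mul]
  ring

/-- A change of chart multiplies the Gram determinant by the square of a Jacobian determinant
which does not depend on the immersion. -/
theorem det_gram_inducedMetric (g : Metric3 M) (f : S → M) (x : S) (y : E2) :
    (gram (inducedMetric g f) x y).det =
      (Matrix.of fun i j => WithLp.ofLp (p := 2) (V := Fin 2 → ℝ) (coordVec x y i) j).det ^ 2 *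
        (firstFundamentalForm g f ((extChartAt 𝓘(ℝ, E2) x).symm y)).det := by
  have h : ∀ i j, gram (inducedMetric g f) x y i j = _ := fun i j =>
    inducedMetric_eq_sum g f ((extChartAt 𝓘(ℝ, E2) x).symm y) (coordVec x y i) (coordVec x y j)
  simp only [Matrix.det_fin_two, h, Fin.sum_univ_two, Matrix.of_apply]
  ring

end Charts

/-! ### The flow in charts -/

section Flow

variable {M : Type*} [TopologicalSpace M] [ChartedSpace E3 M]
  {S : Type*} [TopologicalSpace S] [ChartedSpace E2 S]

/-- The flow `F` in the charts of `S` around `p` and of `M` around `F t₀ p`, as a function of time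
and of the coordinates on `S`. -/
noncomputable def localFlow (F : ℝ → S → M) (t₀ : ℝ) (p : S) (z : ℝ × E2) : E3 :=
  extChartAt 𝓘(ℝ, E3) (F t₀ p) (F z.1 ((extChartAt 𝓘(ℝ, E2) p).symm z.2))

variable {F : ℝ → S → M} {T : ℝ}

theorem contMDiff_slice
    (hF : ContMDiffOn (𝓘(ℝ, ℝ).prod 𝓘(ℝ, E2)) 𝓘(ℝ, E3) ∞
      (fun z : ℝ × S => F z.1 z.2) (Icc 0 T ×ˢ univ)) {t : ℝ} (ht : t ∈ Icc 0 T) :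
    ContMDiff 𝓘(ℝ, E2) 𝓘(ℝ, E3) ∞ (F t) := by
  rw [← contMDiffOn_univ]
  exact hF.comp (contMDiff_const.prodMk contMDiff_id).contMDiffOn fun p _ => ⟨ht, mem_univ p⟩

theorem contMDiffOn_orbit
    (hF : ContMDiffOn (𝓘(ℝ, ℝ).prod 𝓘(ℝ, E2)) 𝓘(ℝ, E3) ∞
      (fun z : ℝ × S => F z.1 z.2) (Icc 0 T ×ˢ univ)) (p : S) :
    ContMDiffOn 𝓘(ℝ, ℝ) 𝓘(ℝ, E3) ∞ (fun s => F s p) (Icc 0 T) :=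
  hF.comp (contMDiff_id.prodMk contMDiff_const).contMDiffOn fun _ hs => ⟨hs, mem_univ p⟩

variable [IsManifold 𝓘(ℝ, E2) ∞ S]

theorem contDiffWithinAt_localFlow
    (hF : ContMDiffOn (𝓘(ℝ, ℝ).prod 𝓘(ℝ, E2)) 𝓘(ℝ, E3) ∞
      (fun z : ℝ × S => F z.1 z.2) (Icc 0 T ×ˢ univ)) {t₀ : ℝ} (ht₀ : t₀ ∈ Icc 0 T) (p : S) :
    ContDiffWithinAt ℝ ∞ (localFlow F t₀ p) (Icc 0 T ×ˢ univ) (t₀, extChartAt 𝓘(ℝ, E2) p p) := by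
  have hsymm : ContMDiffAt 𝓘(ℝ, E2) 𝓘(ℝ, E2) ∞ (extChartAt 𝓘(ℝ, E2) p).symm
      (extChartAt 𝓘(ℝ, E2) p p) :=
    (contMDiffOn_extChartAt_symm p).contMDiffAt (extChartAt_target_mem_nhds p)
  have h1 : ContMDiffWithinAt (𝓘(ℝ, ℝ).prod 𝓘(ℝ, E2)) (𝓘(ℝ, ℝ).prod 𝓘(ℝ, E2)) ∞
      (fun z : ℝ × E2 => (z.1, (extChartAt 𝓘(ℝ, E2) p).symm z.2)) (Icc 0 T ×ˢ univ)
      (t₀, extChartAt 𝓘(ℝ, E2) p p) :=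
    (contMDiffAt_fst.prodMk (hsymm.comp (t₀, extChartAt 𝓘(ℝ, E2) p p)
      contMDiffAt_snd)).contMDiffWithinAt
  have h2 : ContMDiffWithinAt (𝓘(ℝ, ℝ).prod 𝓘(ℝ, E2)) 𝓘(ℝ, E3) ∞
      (fun z : ℝ × S => F z.1 z.2) (Icc 0 T ×ˢ univ)
      (t₀, (extChartAt 𝓘(ℝ, E2) p).symm (extChartAt 𝓘(ℝ, E2) p p)) := hF _ ⟨ht₀, mem_univ _⟩
  have h3 : ContMDiffAt 𝓘(ℝ, E3) 𝓘(ℝ, E3) ∞ (extChartAt 𝓘(ℝ, E3) (F t₀ p))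
      (F t₀ ((extChartAt 𝓘(ℝ, E2) p).symm (extChartAt 𝓘(ℝ, E2) p p))) := by
    rw [extChartAt_to_inv]; exact contMDiffAt_extChartAt
  have h5 : ContMDiffWithinAt (𝓘(ℝ, ℝ).prod 𝓘(ℝ, E2)) 𝓘(ℝ, E3) ∞
      (localFlow F t₀ p) (Icc 0 T ×ˢ univ) (t₀, extChartAt 𝓘(ℝ, E2) p p) :=
    ContMDiffAt.comp_contMDiffWithinAt (t₀, extChartAt 𝓘(ℝ, E2) p p) h3
      (ContMDiffWithinAt.comp (t := Icc 0 T ×ˢ univ) (t₀, extChartAt 𝓘(ℝ, E2) p p) h2 h1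
        fun z hz => mk_mem_prod hz.1 (mem_univ _))
  rw [← modelWithCornersSelf_prod, chartedSpaceSelf_prod] at h5
  exact h5.contDiffWithinAt

theorem contDiffAt_localFlow
    (hF : ContMDiffOn (𝓘(ℝ, ℝ).prod 𝓘(ℝ, E2)) 𝓘(ℝ, E3) ∞
      (fun z : ℝ × S => F z.1 z.2) (Icc 0 T ×ˢ univ)) {t₀ : ℝ} (ht₀ : t₀ ∈ Ioo 0 T) (p : S) :
    ContDiffAt ℝ ∞ (localFlow F t₀ p) (t₀, extChartAt 𝓘(ℝ, E2) p p) :=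
  (contDiffWithinAt_localFlow hF (Ioo_subset_Icc_self ht₀) p).contDiffAt
    (prod_mem_nhds (Icc_mem_nhds ht₀.1 ht₀.2) univ_mem)

variable [IsManifold 𝓘(ℝ, E3) ∞ M]

/-- The Gram matrix of the induced metric in terms of the coordinate expression of the immersion. -/
theorem gram_inducedMetric_eq (g : Metric3 M) {f : S → M} (hf : ContMDiff 𝓘(ℝ, E2) 𝓘(ℝ, E3) ∞ f)
    (q : M) (p : S) {y : E2} (hy : y ∈ (extChartAt 𝓘(ℝ, E2) p).target)
    (hq : f ((extChartAt 𝓘(ℝ, E2) p).symm y) ∈ (extChartAt 𝓘(ℝ, E3) q).source) (i j : Fin 2) :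
    gram (inducedMetric g f) p y i j =
      metricCoordCLM g q (extChartAt 𝓘(ℝ, E3) q (f ((extChartAt 𝓘(ℝ, E2) p).symm y)))
        (fderiv ℝ (extChartAt 𝓘(ℝ, E3) q ∘ f ∘ (extChartAt 𝓘(ℝ, E2) p).symm) y
          (EuclideanSpace.single i (1 : ℝ)))
        (fderiv ℝ (extChartAt 𝓘(ℝ, E3) q ∘ f ∘ (extChartAt 𝓘(ℝ, E2) p).symm) y
          (EuclideanSpace.single j (1 : ℝ))) := by
  have h1 : MDifferentiableAt 𝓘(ℝ, E2) 𝓘(ℝ, E2) (extChartAt 𝓘(ℝ, E2) p).symm y :=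
    ((contMDiffOn_extChartAt_symm (n := ∞) p).contMDiffAt
      ((isOpen_extChartAt_target p).mem_nhds hy)).mdifferentiableAt (by simp)
  have h2 := hf.mdifferentiableAt (by simp) (x := (extChartAt 𝓘(ℝ, E2) p).symm y)
  have h3 : MDifferentiableAt 𝓘(ℝ, E2) 𝓘(ℝ, E3) (f ∘ (extChartAt 𝓘(ℝ, E2) p).symm) y :=
    h2.comp y h1
  rw [metricCoordCLM_extChartAt g q hq]
  have h4 := mfderiv_eq_mfderiv_extChartAt_symm q h3 hq
  have h5 := mfderiv_comp y h2 h1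
  have h6 : ∀ a : E2, (mfderiv 𝓘(ℝ, E2) 𝓘(ℝ, E3) f ((extChartAt 𝓘(ℝ, E2) p).symm y)
      (mfderiv 𝓘(ℝ, E2) 𝓘(ℝ, E2) (extChartAt 𝓘(ℝ, E2) p).symm y a) : E3) =
    (mfderiv 𝓘(ℝ, E2) 𝓘(ℝ, E3) (f ∘ (extChartAt 𝓘(ℝ, E2) p).symm) y a : E3) := fun a => by
    rw [h5]; rfl
  change (g.inner (f ((extChartAt 𝓘(ℝ, E2) p).symm y)) : E3 →L[ℝ] E3 →L[ℝ] ℝ)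
    (mfderiv 𝓘(ℝ, E2) 𝓘(ℝ, E3) f ((extChartAt 𝓘(ℝ, E2) p).symm y)
      (mfderiv 𝓘(ℝ, E2) 𝓘(ℝ, E2) (extChartAt 𝓘(ℝ, E2) p).symm y _) : E3)
    (mfderiv 𝓘(ℝ, E2) 𝓘(ℝ, E3) f ((extChartAt 𝓘(ℝ, E2) p).symm y)
      (mfderiv 𝓘(ℝ, E2) 𝓘(ℝ, E2) (extChartAt 𝓘(ℝ, E2) p).symm y _) : E3) = _
  rw [h6, h6, h4, h4]
  rfl

end Flow

/-! ### Evolution of the first fundamental form -/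

section Variation

variable {M : Type*} [TopologicalSpace M] [ChartedSpace E3 M]
  {S : Type*} [TopologicalSpace S] [ChartedSpace E2 S]
  [IsManifold 𝓘(ℝ, E3) ∞ M] [IsManifold 𝓘(ℝ, E2) ∞ S] {F : ℝ → S → M} {T : ℝ}

/-- Continuity up to the ends of the time interval, where the flow is differentiable only
within `[0, T]`. -/
theorem continuousOn_firstFundamentalForm (g : Metric3 M)
    (hF : ContMDiffOn (𝓘(ℝ, ℝ).prod 𝓘(ℝ, E2)) 𝓘(ℝ, E3) ∞
      (fun z : ℝ × S => F z.1 z.2) (Icc 0 T ×ˢ univ)) (p : S) (i j : Fin 2) :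
    ContinuousOn (fun s => firstFundamentalForm g (F s) p i j) (Icc 0 T) := by
  intro t₀ ht₀
  obtain ⟨x, hx⟩ : ∃ x, x = extChartAt 𝓘(ℝ, E2) p p := ⟨_, rfl⟩
  have hp : (extChartAt 𝓘(ℝ, E2) p).symm x = p := by rw [hx, extChartAt_to_inv]
  have hU : ContDiffWithinAt ℝ ∞ (localFlow F t₀ p) (Icc 0 T ×ˢ univ) (t₀, x) :=
    hx ▸ contDiffWithinAt_localFlow hF ht₀ p
  have hD : ContinuousWithinAt (fun s => fderiv ℝ (fun y => localFlow F t₀ p (s, y)) x)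
      (Icc 0 T) t₀ := by
    have h := ContDiffWithinAt.fderivWithin (m := 0) (f := fun s y => localFlow F t₀ p (s, y))
      (g := fun _ => x) (s := Icc 0 T) (t := univ) (x₀ := t₀) (n := ∞) hU contDiffWithinAt_const
      uniqueDiffOn_univ (by simp) ht₀ (fun _ _ => mem_univ _)
    simpa only [fderivWithin_univ] using h.continuousWithinAt
  have hbase : ContinuousWithinAt (fun s => localFlow F t₀ p (s, x)) (Icc 0 T) t₀ :=
    hU.continuousWithinAt.comp (t := Icc 0 T ×ˢ univ) (f := fun s => (s, x))
      (by fun_prop) fun s hs => mk_mem_prod hs (mem_univ _)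
  have hsource : ∀ᶠ s in 𝓝[Icc 0 T] t₀, F s p ∈ (extChartAt 𝓘(ℝ, E3) (F t₀ p)).source :=
    ((contMDiffOn_orbit hF p).continuousOn t₀ ht₀).preimage_mem_nhdsWithin
      (extChartAt_source_mem_nhds _)
  have hG : ContinuousAt (metricCoordCLM g (F t₀ p)) (localFlow F t₀ p (t₀, x)) := by
    refine (differentiableAt_metricCoordCLM g _ ?_).continuousAt
    simp only [localFlow, hp]
    exact mem_extChartAt_target _
  have hvec : ∀ i : Fin 2, ContinuousWithinAt (fun s => fderiv ℝ
      (fun y => localFlow F t₀ p (s, y)) x (EuclideanSpace.single i (1 : ℝ))) (Icc 0 T) t₀ :=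
    fun i => hD.clm_apply continuousWithinAt_const
  have hmain := ((ContinuousAt.comp_continuousWithinAt (f := fun s => localFlow F t₀ p (s, x))
    hG hbase).clm_apply (hvec i)).clm_apply (hvec j)
  refine ContinuousWithinAt.congr_of_eventuallyEq_of_mem hmain ?_ ht₀
  · filter_upwards [self_mem_nhdsWithin, hsource] with s hs hsrc
    have h := gram_inducedMetric_eq g (contMDiff_slice hF hs) (F t₀ p) p (y := x)
      (hx ▸ mem_extChartAt_target p) (by rwa [hp]) i j
    rw [firstFundamentalForm, ← hx, h]
    rfl

/-- The variation formula `∂_t g_ij = 2 A_ij / H` of inverse mean curvature flow. -/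
theorem hasDerivAt_firstFundamentalForm {g : Metric3 M}
    {ν : ∀ (t : ℝ) (p : S), TangentSpace 𝓘(ℝ, E3) (F t p)} (hF : IsSolution g T F ν) {t : ℝ}
    (ht : t ∈ Ioo 0 T) (p : S) (i j : Fin 2) :
    HasDerivAt (fun s => firstFundamentalForm g (F s) p i j)
      (2 * (meanCurvature g (F t) p (ν t p))⁻¹ *
        secondFundamentalForm g (F t) p (ν t p) i j) t := by
  have htI : t ∈ Icc 0 T := Ioo_subset_Icc_self ht
  have hIcc : Icc 0 T ∈ 𝓝 t := Icc_mem_nhds ht.1 ht.2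
  obtain ⟨x, hx⟩ : ∃ x, x = extChartAt 𝓘(ℝ, E2) p p := ⟨_, rfl⟩
  have hp : (extChartAt 𝓘(ℝ, E2) p).symm x = p := by rw [hx, extChartAt_to_inv]
  obtain ⟨U, hUdef⟩ : ∃ U, U = localFlow F t p := ⟨_, rfl⟩
  have hU : ContDiffAt ℝ ∞ U (t, x) := by
    rw [hUdef, hx]; exact contDiffAt_localFlow hF.smooth ht p
  have hU2 : ContDiffAt ℝ 2 U (t, x) := hU.of_le (WithTop.coe_le_coe.2 (le_top (a := (2 : ℕ∞))))
  have hUd : ∀ᶠ z in 𝓝 (t, x), DifferentiableAt ℝ U z :=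
    (hU2.eventually (by simp)).mono fun z hz => hz.differentiableAt (by norm_num)
  have hUx : U (t, x) = extChartAt 𝓘(ℝ, E3) (F t p) (F t p) := by
    rw [hUdef]; simp only [localFlow, hp]
  have hUmem : U (t, x) ∈ (extChartAt 𝓘(ℝ, E3) (F t p)).target := hUx ▸ mem_extChartAt_target _
  -- partial derivatives of `U`
  have hspace : ∀ s y, DifferentiableAt ℝ U (s, y) → ∀ b, fderiv ℝ U (s, y) (0, b) =
      fderiv ℝ (extChartAt 𝓘(ℝ, E3) (F t p) ∘ F s ∘ (extChartAt 𝓘(ℝ, E2) p).symm) y b := by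
    intro s y h b
    have h1 := HasFDerivAt.comp (g := U) (f := fun y => (s, y)) y h.hasFDerivAt
      (hasFDerivAt_prodMk_right s y)
    rw [hUdef] at h1 ⊢
    exact congr($(h1.fderiv.symm) b)
  have htime : ∀ y, DifferentiableAt ℝ U (t, y) → fderiv ℝ U (t, y) (1, 0) =
      fderiv ℝ (extChartAt 𝓘(ℝ, E3) (F t p) ∘ fun s => F s ((extChartAt 𝓘(ℝ, E2) p).symm y))
        t 1 := by
    intro y h
    have h1 := HasFDerivAt.comp (g := U) (f := fun s => (s, y)) t h.hasFDerivAt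
      (hasFDerivAt_prodMk_left t y)
    rw [hUdef] at h1 ⊢
    exact congr($(h1.fderiv.symm) 1)
  have horbit : ∀ p', MDifferentiableAt 𝓘(ℝ, ℝ) 𝓘(ℝ, E3) (fun s => F s p') t := fun p' =>
    ((contMDiffOn_orbit hF.smooth p').contMDiffAt hIcc).mdifferentiableAt (by simp)
  have hflow : ∀ p', mfderiv 𝓘(ℝ, ℝ) 𝓘(ℝ, E3) (fun s => F s p') t (1 : ℝ) =
      (meanCurvature g (F t) p' (ν t p'))⁻¹ • ν t p' := fun p' => by
    rw [← hF.flow t ⟨ht.1.le, ht.2⟩ p', mfderivWithin_of_mem_nhds hIcc]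
  have hslice := contMDiff_slice hF.smooth htI
  -- the velocity is normal to the surface at all nearby points
  have horth : ∀ᶠ y in 𝓝 x, ∀ b, metricCoordCLM g (F t p) (U (t, y))
      (fderiv ℝ U (t, y) (1, 0)) (fderiv ℝ U (t, y) (0, b)) = 0 := by
    have hcont : Tendsto (fun y => (t, y)) (𝓝 x) (𝓝 (t, x)) :=
      (Continuous.prodMk_right t).tendsto x
    have htarget : ∀ᶠ y in 𝓝 x, y ∈ (extChartAt 𝓘(ℝ, E2) p).target :=
      hx ▸ extChartAt_target_mem_nhds p
    have hsymmcont : ContinuousAt (extChartAt 𝓘(ℝ, E2) p).symm x :=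
      hx ▸ continuousAt_extChartAt_symm p
    have hsource : ∀ᶠ y in 𝓝 x, F t ((extChartAt 𝓘(ℝ, E2) p).symm y) ∈
        (extChartAt 𝓘(ℝ, E3) (F t p)).source := by
      refine (hslice.continuous.continuousAt.comp hsymmcont).preimage_mem_nhds ?_
      simp only [Function.comp, hp]
      exact extChartAt_source_mem_nhds _
    filter_upwards [hcont.eventually hUd, htarget, hsource] with y hy hyt hys b
    have h1 : MDifferentiableAt 𝓘(ℝ, E2) 𝓘(ℝ, E2) (extChartAt 𝓘(ℝ, E2) p).symm y :=
      ((contMDiffOn_extChartAt_symm (n := ∞) p).contMDiffAt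
        ((isOpen_extChartAt_target p).mem_nhds hyt)).mdifferentiableAt (by simp)
    have h2 := hslice.mdifferentiableAt (by simp) (x := (extChartAt 𝓘(ℝ, E2) p).symm y)
    have h3 : MDifferentiableAt 𝓘(ℝ, E2) 𝓘(ℝ, E3) (F t ∘ (extChartAt 𝓘(ℝ, E2) p).symm) y :=
      h2.comp y h1
    have hUy : U (t, y) = extChartAt 𝓘(ℝ, E3) (F t p) (F t ((extChartAt 𝓘(ℝ, E2) p).symm y)) := by
      rw [hUdef]; rfl
    have h4 := mfderiv_eq_mfderiv_extChartAt_symm (F t p) h3 hys b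
    have h5 := mfderiv_eq_mfderiv_extChartAt_symm (F t p)
      (horbit ((extChartAt 𝓘(ℝ, E2) p).symm y)) hys 1
    rw [hflow] at h5
    rw [mfderiv_comp y h2 h1] at h4
    rw [hspace t y hy, htime y hy, hUy, metricCoordCLM_extChartAt g _ hys]
    refine Eq.trans (congrArg₂ (fun v w : E3 => (g.inner (F t ((extChartAt 𝓘(ℝ, E2) p).symm y)) :
      E3 →L[ℝ] E3 →L[ℝ] ℝ) v w) h5.symm h4.symm) ?_
    have h6 := (hF.normal t htI ((extChartAt 𝓘(ℝ, E2) p).symm y)).orthogonal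
      (mfderiv 𝓘(ℝ, E2) 𝓘(ℝ, E2) (extChartAt 𝓘(ℝ, E2) p).symm y b)
    have h7 : ∀ (B : E3 →L[ℝ] E3 →L[ℝ] ℝ) (c : ℝ) (v w : E3), B v w = 0 → B (c • v) w = 0 :=
      fun B c v w h => by rw [map_smul, smul_apply, h, smul_zero]
    exact h7 _ _ _ _ h6
  -- the velocity in coordinates
  have hW : fderiv ℝ U (t, x) (1, 0) = (meanCurvature g (F t) p (ν t p))⁻¹ •
      (mfderiv 𝓘(ℝ, E3) 𝓘(ℝ, E3) (extChartAt 𝓘(ℝ, E3) (F t p)) (F t p) (ν t p) : E3) := by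
    rw [htime x hUd.self_of_nhds, hp, ← mfderiv_eq_fderiv,
      mfderiv_comp t (mdifferentiableAt_extChartAt_of_mem _ (mem_extChartAt_source _)) (horbit p)]
    have h1 := hflow p
    have h2 : ∀ (L : E3 →L[ℝ] E3) (c : ℝ) (v w : E3), v = c • w → L v = c • L w :=
      fun L c v w h => by rw [h, map_smul]
    exact h2 (mfderiv 𝓘(ℝ, E3) 𝓘(ℝ, E3) (extChartAt 𝓘(ℝ, E3) (F t p)) (F t p)) _ _ _ h1
  -- the Hessian of `F t` in coordinates is the spatial part of the Hessian of `U`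
  have hsecond : ∀ a b : E2, fderiv ℝ (fderiv ℝ (extChartAt 𝓘(ℝ, E3) (F t p) ∘ F t ∘
      (extChartAt 𝓘(ℝ, E2) p).symm)) x a b = fderiv ℝ (fderiv ℝ U) (t, x) (0, a) (0, b) := by
    intro a b
    have hcont : Tendsto (fun y => (t, y)) (𝓝 x) (𝓝 (t, x)) :=
      (Continuous.prodMk_right t).tendsto x
    have hev : fderiv ℝ (extChartAt 𝓘(ℝ, E3) (F t p) ∘ F t ∘ (extChartAt 𝓘(ℝ, E2) p).symm)
        =ᶠ[𝓝 x] fun y => (fderiv ℝ U (t, y)).comp (ContinuousLinearMap.inr ℝ ℝ E2) := by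
      filter_upwards [hcont.eventually hUd] with y hy
      ext1 c
      exact (hspace t y hy c).symm
    have hK : HasFDerivAt (fderiv ℝ U) (fderiv ℝ (fderiv ℝ U) (t, x)) (t, x) :=
      ((hU2.fderiv_right (m := 1) (by norm_num)).differentiableAt (by norm_num)).hasFDerivAt
    have hK' := HasFDerivAt.comp (g := fderiv ℝ U) (f := fun y => (t, y)) x hK
      (hasFDerivAt_prodMk_right t x)
    rw [((hK'.clm_comp (hasFDerivAt_const (ContinuousLinearMap.inr ℝ ℝ E2) x)).congr_of_eventuallyEq
      hev).fderiv]
    simp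
  have hmain := hasDerivAt_inducedMetric_of_orthogonal hU2
    (differentiableAt_metricCoordCLM g (F t p) hUmem) (metricCoordCLM_symm g (F t p)) horth
    (EuclideanSpace.single i (1 : ℝ)) (EuclideanSpace.single j (1 : ℝ))
  rw [← christoffel_eq g (F t p) hUmem] at hmain
  refine (hmain.congr_of_eventuallyEq ?_).congr_deriv ?_
  · have hcont : Tendsto (fun s => (s, x)) (𝓝 t) (𝓝 (t, x)) :=
      (Continuous.prodMk_left x).tendsto t
    have hsource : ∀ᶠ s in 𝓝 t, F s p ∈ (extChartAt 𝓘(ℝ, E3) (F t p)).source :=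
      (horbit p).continuousAt.preimage_mem_nhds (extChartAt_source_mem_nhds _)
    filter_upwards [hcont.eventually hUd, hsource, hIcc] with s hsd hss hsI
    have h := gram_inducedMetric_eq g (contMDiff_slice hF.smooth hsI) (F t p) p (y := x)
      (hx ▸ mem_extChartAt_target p) (by rwa [hp]) i j
    rw [firstFundamentalForm, ← hx, h, hspace s x hsd, hspace s x hsd, hUdef]
    rfl
  · have hux : (extChartAt 𝓘(ℝ, E3) (F t p) ∘ F t ∘ (extChartAt 𝓘(ℝ, E2) p).symm) x = U (t, x) := by
      rw [hUdef]; rfl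
    have hscale : ∀ (c : ℝ) (d a b n w : E3), w = c • n →
        -2 * (metricCoordCLM g (F t p) (U (t, x)) d w + christoffel g (F t p) (U (t, x)) a b w) =
          2 * c * -(metricCoord g (F t p) (U (t, x)) d n +
            christoffel g (F t p) (U (t, x)) a b n) := by
      rintro c d a b n w rfl
      rw [christoffel_eq g (F t p) hUmem, christoffel_eq g (F t p) hUmem, ← metricCoordCLM_apply]
      simp only [map_smul, smul_apply, smul_eq_mul]
      ring
    simp only [secondFundamentalForm, Matrix.of_apply, ← hx, hsecond]
    rw [hux, ← hspace t x hUd.self_of_nhds, ← hspace t x hUd.self_of_nhds]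
    exact hscale _ _ _ _ _ _ hW

end Variation

/-! ### Growth estimates along the flow -/

section Evolution

variable {M : Type*} [TopologicalSpace M] [ChartedSpace E3 M]
  {S : Type*} [TopologicalSpace S] [ChartedSpace E2 S]
  [IsManifold 𝓘(ℝ, E3) ∞ M] [IsManifold 𝓘(ℝ, E2) ∞ S]

/-- Grönwall's inequality with the derivative given in the open interval only. Replacing `φ` by `-φ`
gives bounds from below, so no sign of `φ` is assumed. -/
theorem le_mul_exp_of_deriv_le {φ φ' : ℝ → ℝ} {T k : ℝ} (hφ : ContinuousOn φ (Icc 0 T))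
    (hd : ∀ t ∈ Ioo 0 T, HasDerivAt φ (φ' t) t) (hle : ∀ t ∈ Ioo 0 T, φ' t ≤ k * φ t) {t : ℝ}
    (ht : t ∈ Icc 0 T) : φ t ≤ φ 0 * Real.exp (k * t) := by
  have hanti : AntitoneOn (fun s => φ s * Real.exp (-(k * s))) (Icc 0 T) := by
    have hderiv : ∀ s ∈ Ioo 0 T, HasDerivAt (fun s => φ s * Real.exp (-(k * s)))
        ((φ' s - k * φ s) * Real.exp (-(k * s))) s := fun s hs => by
      refine ((hd s hs).mul ((hasDerivAt_id s).const_mul k).neg.exp).congr_deriv ?_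
      simp only [id, Pi.neg_apply]
      ring
    refine antitoneOn_of_deriv_nonpos (convex_Icc 0 T) (hφ.mul (by fun_prop)) ?_ ?_
    · rw [interior_Icc]
      exact fun s hs => (hderiv s hs).differentiableAt.differentiableWithinAt
    · rw [interior_Icc]
      intro s hs
      rw [(hderiv s hs).deriv]
      exact mul_nonpos_of_nonpos_of_nonneg (sub_nonpos.2 (hle s hs)) (Real.exp_pos _).le
  have h := hanti (left_mem_Icc.2 (ht.1.trans ht.2)) ht ht.1
  simp only [mul_zero, neg_zero, Real.exp_zero, mul_one, Real.exp_neg] at h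
  rwa [← div_eq_mul_inv, div_le_iff₀ (Real.exp_pos _)] at h

theorem inducedMetric_self_eq (g : Metric3 M) (f : S → M) (p : S) (X : E2) :
    inducedMetric g f p X X = firstFundamentalForm g f p 0 0 * X 0 ^ 2 +
      2 * firstFundamentalForm g f p 0 1 * (X 0 * X 1) +
      firstFundamentalForm g f p 1 1 * X 1 ^ 2 := by
  rw [inducedMetric_eq_sum]
  simp only [Fin.sum_univ_two, firstFundamentalForm_symm g f p 1 0]
  ring

/-- Where the mean curvature does not vanish, the first fundamental form is positive definite. A
degenerate form has the junk inverse `0`, and the mean curvature would be zero. -/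
theorem firstFundamentalForm_pos {g : Metric3 M} {f : S → M} {p : S}
    {n : TangentSpace 𝓘(ℝ, E3) (f p)} (hH : meanCurvature g f p n ≠ 0) :
    0 < firstFundamentalForm g f p 0 0 ∧ 0 < (firstFundamentalForm g f p).det := by
  have hdet : (firstFundamentalForm g f p).det ≠ 0 := by
    intro h
    refine hH ?_
    rw [meanCurvature, Matrix.nonsing_inv_apply_not_isUnit _ (by simp [h])]
    simp
  have hq : ∀ x y : ℝ, 0 ≤ firstFundamentalForm g f p 0 0 * x ^ 2 +
      2 * firstFundamentalForm g f p 0 1 * (x * y) + firstFundamentalForm g f p 1 1 * y ^ 2 :=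
    fun x y => by
      simpa using (inducedMetric_self_nonneg g f p (!₂[x, y] : E2)).trans_eq
        (inducedMetric_self_eq g f p !₂[x, y])
  have hs := firstFundamentalForm_symm g f p 1 0
  rw [Matrix.det_fin_two, hs] at hdet ⊢
  set a := firstFundamentalForm g f p 0 0
  set b := firstFundamentalForm g f p 0 1
  set c := firstFundamentalForm g f p 1 1
  have ha : 0 ≤ a := by simpa using hq 1 0
  have hc : 0 ≤ c := by simpa using hq 0 1
  have hpos : 0 < a * c - b * b := by
    refine lt_of_le_of_ne ?_ hdet.symm
    by_contra! hneg
    -- the form takes the values `a det` and `c det` at `(b, -a)` and `(c, -b)`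
    have h1 : 0 ≤ a * (a * c - b * b) := by nlinarith [hq b (-a)]
    have h2 : 0 ≤ c * (a * c - b * b) := by nlinarith [hq c (-b)]
    have ha0 : a = 0 := le_antisymm (by by_contra! h; nlinarith) ha
    have hc0 : c = 0 := le_antisymm (by by_contra! h; nlinarith) hc
    have h3 := hq 1 (-b)
    rw [ha0, hc0] at h3 hneg
    nlinarith
  exact ⟨lt_of_le_of_ne ha fun h => by rw [← h] at hpos; nlinarith [mul_self_nonneg b], hpos⟩

variable {g : Metric3 M} {T : ℝ} {F : ℝ → S → M}
  {ν : ∀ (t : ℝ) (p : S), TangentSpace 𝓘(ℝ, E3) (F t p)}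

/-- The second fundamental form is symmetric along the flow, as it is a nonzero multiple of the
time derivative of the metric. -/
theorem secondFundamentalForm_symm (hF : IsSolution g T F ν) {t : ℝ} (ht : t ∈ Ioo 0 T) (p : S)
    (i j : Fin 2) : secondFundamentalForm g (F t) p (ν t p) i j =
      secondFundamentalForm g (F t) p (ν t p) j i := by
  have h := (hasDerivAt_firstFundamentalForm hF ht p i j).unique
    ((hasDerivAt_firstFundamentalForm hF ht p j i).congr_of_eventuallyEq
      (.of_forall fun s => firstFundamentalForm_symm g (F s) p i j))
  have hH := hF.meanCurvature_ne_zero t ⟨ht.1.le, ht.2⟩ p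
  exact mul_left_cancel₀ (mul_ne_zero two_ne_zero (inv_ne_zero hH)) h

/-- The determinant of the induced metric solves `y' = 2 y`. -/
theorem det_firstFundamentalForm_eq (hF : IsSolution g T F ν) {t : ℝ} (ht : t ∈ Icc 0 T) (p : S) :
    (firstFundamentalForm g (F t) p).det =
      (firstFundamentalForm g (F 0) p).det * Real.exp (2 * t) := by
  have hcont : ContinuousOn (fun s => (firstFundamentalForm g (F s) p).det) (Icc 0 T) := by
    have h := continuousOn_firstFundamentalForm g hF.smooth p
    simp only [Matrix.det_fin_two]
    exact ((h 0 0).mul (h 1 1)).sub ((h 0 1).mul (h 1 0))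
  have hd : ∀ s ∈ Ioo 0 T, HasDerivAt (fun s => (firstFundamentalForm g (F s) p).det)
      (2 * (firstFundamentalForm g (F s) p).det) s := by
    intro s hs
    have hH := hF.meanCurvature_ne_zero s ⟨hs.1.le, hs.2⟩ p
    have h := hasDerivAt_det_fin_two (h := fun s => firstFundamentalForm g (F s) p)
      (firstFundamentalForm_pos hH).2.ne' (hasDerivAt_firstFundamentalForm hF hs p)
    refine h.congr_deriv ?_
    rw [← meanCurvature, mul_assoc 2, inv_mul_cancel₀ hH, mul_one]
  refine le_antisymm (le_mul_exp_of_deriv_le hcont hd (fun _ _ => le_rfl) ht) ?_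
  have h := le_mul_exp_of_deriv_le (k := 2) hcont.neg (fun s hs => (hd s hs).neg)
    (fun s _ => by simp) ht
  simpa using h

/-- The differential inequality for the squared length of a fixed tangent vector. -/
theorem abs_deriv_inducedMetric_le {H₀ A₀ : ℝ} (hF : IsSolution g T F ν) (hH₀ : 0 < H₀)
    (hH : ∀ t ∈ Icc 0 T, ∀ p, H₀ ≤ meanCurvature g (F t) p (ν t p))
    (hA : ∀ t ∈ Icc 0 T, ∀ p, normA g (F t) p (ν t p) ≤ A₀) (p : S) (X : E2) {t : ℝ}
    (ht : t ∈ Ioo 0 T) :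
    ∃ d, HasDerivAt (fun s => inducedMetric g (F s) p X X) d t ∧
      |d| ≤ 2 * A₀ / H₀ * inducedMetric g (F t) p X X := by
  have htI := Ioo_subset_Icc_self ht
  have hHt := hH t htI p
  have hHpos : 0 < meanCurvature g (F t) p (ν t p) := hH₀.trans_le hHt
  have hpos := firstFundamentalForm_pos hHpos.ne'
  have hD := hasDerivAt_firstFundamentalForm hF ht p
  have hquad := abs_quadraticForm_le _ _ (firstFundamentalForm_symm g (F t) p 0 1)
    (secondFundamentalForm_symm hF ht p 0 1) hpos.1 hpos.2 (X 0) (X 1)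
  rw [← inducedMetric_self_eq, ← normA] at hquad
  refine ⟨2 * (meanCurvature g (F t) p (ν t p))⁻¹ *
    (secondFundamentalForm g (F t) p (ν t p) 0 0 * X 0 ^ 2 +
      2 * secondFundamentalForm g (F t) p (ν t p) 0 1 * (X 0 * X 1) +
      secondFundamentalForm g (F t) p (ν t p) 1 1 * X 1 ^ 2), ?_, ?_⟩
  · simp only [inducedMetric_self_eq]
    refine ((((hD 0 0).mul_const _).add (((hD 0 1).const_mul 2).mul_const _)).add
      ((hD 1 1).mul_const _)).congr_deriv ?_
    ring
  · have hq := inducedMetric_self_nonneg g (F t) p X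
    have hA0 : 0 ≤ A₀ := (Real.sqrt_nonneg _).trans (hA t htI p)
    rw [abs_mul, abs_of_pos (by positivity)]
    calc _ ≤ 2 * H₀⁻¹ * (A₀ * inducedMetric g (F t) p X X) := by
          gcongr
          exact hquad.trans (mul_le_mul_of_nonneg_right (hA t htI p) hq)
      _ = _ := by ring

/-- Along the flow the metric changes at most by the factor `exp (± 2 A₀ t / H₀)`. -/
theorem inducedMetric_self_bounds {H₀ A₀ : ℝ} (hF : IsSolution g T F ν) (hH₀ : 0 < H₀)
    (hH : ∀ t ∈ Icc 0 T, ∀ p, H₀ ≤ meanCurvature g (F t) p (ν t p))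
    (hA : ∀ t ∈ Icc 0 T, ∀ p, normA g (F t) p (ν t p) ≤ A₀) (p : S)
    (X : TangentSpace 𝓘(ℝ, E2) p) {t : ℝ} (ht : t ∈ Icc 0 T) :
    inducedMetric g (F 0) p X X * Real.exp (-(2 * A₀ / H₀) * t) ≤ inducedMetric g (F t) p X X ∧
      inducedMetric g (F t) p X X ≤
        inducedMetric g (F 0) p X X * Real.exp (2 * A₀ / H₀ * t) := by
  choose! φ' hφ' hle using fun s (hs : s ∈ Ioo 0 T) =>
    abs_deriv_inducedMetric_le hF hH₀ hH hA p X hs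
  have hcont : ContinuousOn (fun s => inducedMetric g (F s) p X X) (Icc 0 T) := by
    have h := continuousOn_firstFundamentalForm g hF.smooth p
    have hX := fun s => inducedMetric_self_eq g (F s) p X
    refine ContinuousOn.congr ?_ fun s _ => hX s
    exact (((h 0 0).mul continuousOn_const).add
      ((continuousOn_const.mul (h 0 1)).mul continuousOn_const)).add
        ((h 1 1).mul continuousOn_const)
  refine ⟨?_, le_mul_exp_of_deriv_le hcont hφ'
    (fun s hs => (le_abs_self _).trans (hle s hs)) ht⟩
  have h := le_mul_exp_of_deriv_le (k := -(2 * A₀ / H₀)) hcont.neg (fun s hs => (hφ' s hs).neg)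
    (fun s hs => by
      have := (neg_le_abs _).trans (hle s hs)
      simpa using this) ht
  simpa using h

end Evolution

/-! ### Scaling of lengths, areas and isoperimetric constants -/

section Scaling

theorem sqrt_mul_exp_le {a b c : ℝ} (ha : 0 ≤ a) (hc : c ≤ 0) (h : a * Real.exp c ≤ b) :
    √a * Real.exp c ≤ √b := by
  refine Real.le_sqrt_of_sq_le ?_
  rw [mul_pow, Real.sq_sqrt ha]
  refine le_trans (mul_le_mul_of_nonneg_left ?_ ha) h
  rw [← Real.exp_nat_mul]
  exact Real.exp_le_exp.2 (by push_cast; linarith)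

variable {S : Type*} [TopologicalSpace S] [ChartedSpace E2 S]

/-- If `h` is bounded from below by a multiple of `h₀`, so are the lengths. As `exp c` is at most
`1`, it may stand in place of its square root. The sign of `c` matters only if `S` has a point. -/
theorem curveLength_mul_exp_le {h₀ h : FormField S} {c : ℝ} (hh₀ : ∀ p X, 0 ≤ h₀ p X X)
    (hc : ∀ _ : S, c ≤ 0) (hle : ∀ p X, h₀ p X X * Real.exp c ≤ h p X X) (γ : ℝ → S) (a b : ℝ) :
    curveLength h₀ γ a b * ENNReal.ofReal (Real.exp c) ≤ curveLength h γ a b := by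
  rw [curveLength, curveLength, ← lintegral_mul_const' _ _ ENNReal.ofReal_ne_top]
  refine lintegral_mono fun s => ?_
  rw [← ENNReal.ofReal_mul (Real.sqrt_nonneg _)]
  exact ENNReal.ofReal_le_ofReal (sqrt_mul_exp_le (hh₀ _ _) (hc (γ s)) (hle _ _))

variable [MeasurableSpace S]

theorem area_le_smul {h₀ h : FormField S} {c : ℝ}
    (hdet : ∀ x y, (gram h x y).det = (gram h₀ x y).det * Real.exp (2 * c)) :
    area h ≤ ENNReal.ofReal (Real.exp c) • area h₀ := by
  refine iSup_le fun x => ?_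
  have hdens : (fun y => ENNReal.ofReal (√(gram h x y).det)) =
      ENNReal.ofReal (Real.exp c) • fun y => ENNReal.ofReal (√(gram h₀ x y).det) := by
    funext y
    have hexp : Real.exp (2 * c) = Real.exp c ^ 2 := by
      rw [← Real.exp_nat_mul]; norm_num
    rw [Pi.smul_apply, smul_eq_mul, ← ENNReal.ofReal_mul (Real.exp_pos c).le, hdet, hexp,
      Real.sqrt_mul' _ (by positivity), Real.sqrt_sq (Real.exp_pos c).le, mul_comm]
  rw [chartArea, hdens, withDensity_smul' _ _ ENNReal.ofReal_ne_top, Measure.map_smul]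
  refine Measure.le_iff'.2 fun s => ?_
  simp only [Measure.smul_apply, smul_eq_mul]
  exact mul_le_mul_right (Measure.le_iff'.1 (le_iSup (fun x => chartArea h₀ x) x) s) _

/-- The area measure scales with the square root of the Gram determinant. -/
theorem area_eq_smul {h₀ h : FormField S} {c : ℝ}
    (hdet : ∀ x y, (gram h x y).det = (gram h₀ x y).det * Real.exp (2 * c)) :
    area h = ENNReal.ofReal (Real.exp c) • area h₀ := by
  refine le_antisymm (area_le_smul hdet) ?_
  have h1 : area h₀ ≤ ENNReal.ofReal (Real.exp (-c)) • area h := area_le_smul fun x y => by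
    rw [hdet, mul_assoc, ← Real.exp_add]; simp
  refine Measure.le_iff'.2 fun s => ?_
  have h2 := Measure.le_iff'.1 h1 s
  simp only [Measure.smul_apply, smul_eq_mul] at h2 ⊢
  refine (mul_le_mul_right h2 _).trans ?_
  rw [← mul_assoc, ← ENNReal.ofReal_mul (Real.exp_pos c).le, ← Real.exp_add]
  simp

/-- Lengths bounded from below with factor `exp c` and areas multiplied by `exp d` bound the
isoperimetric quotients, and so their infimum, from below with factor `exp (c - d / α)`. -/
theorem isoperimetricInf_mul_exp_le {h₀ h : FormField S} {c d : ℝ}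
    (hL : ∀ γ : ℝ → S, curveLength h₀ γ 0 1 * ENNReal.ofReal (Real.exp c) ≤ curveLength h γ 0 1)
    (hA : area h = ENNReal.ofReal (Real.exp d) • area h₀) (k : ℕ) {α : ℝ} (hα : 0 < α) :
    isoperimetricInf k α h₀ * ENNReal.ofReal (Real.exp (c - 1 / α * d)) ≤
      isoperimetricInf k α h := by
  refine le_iInf fun γ => le_iInf fun S₁ => le_iInf fun S₂ => le_iInf fun hsep => ?_
  have h1 : isoperimetricInf k α h₀ ≤
      (∑ i, curveLength h₀ (γ i) 0 1) / (min (area h₀ S₁) (area h₀ S₂)) ^ (1 / α) :=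
    iInf_le_of_le γ (iInf_le_of_le S₁ (iInf_le_of_le S₂ (iInf_le_of_le hsep le_rfl)))
  refine (mul_le_mul_left h1 _).trans ?_
  have hmin : min (area h S₁) (area h S₂) =
      ENNReal.ofReal (Real.exp d) * min (area h₀ S₁) (area h₀ S₂) := by
    simp only [hA, Measure.smul_apply, smul_eq_mul]
    exact (Monotone.map_min fun a b hab => by gcongr).symm
  have hpow : ENNReal.ofReal (Real.exp d) ^ (1 / α) = ENNReal.ofReal (Real.exp (1 / α * d)) := by
    rw [ENNReal.ofReal_rpow_of_pos (Real.exp_pos d), ← Real.exp_mul, mul_comm]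
  have hpos : ENNReal.ofReal (Real.exp (1 / α * d)) ≠ 0 := by
    simpa using Real.exp_pos _
  have hsplit : ENNReal.ofReal (Real.exp (c - 1 / α * d)) =
      ENNReal.ofReal (Real.exp c) * (ENNReal.ofReal (Real.exp (1 / α * d)))⁻¹ := by
    rw [← ENNReal.ofReal_inv_of_pos (Real.exp_pos _), ← ENNReal.ofReal_mul (Real.exp_pos _).le,
      sub_eq_add_neg, Real.exp_add, Real.exp_neg]
  rw [hmin, ENNReal.mul_rpow_of_nonneg _ _ (by positivity), hpow, hsplit, ENNReal.div_eq_inv_mul,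
    ENNReal.div_eq_inv_mul, ENNReal.mul_inv (.inl hpos) (.inl ENNReal.ofReal_ne_top)]
  have hsum : (∑ i, curveLength h₀ (γ i) 0 1) * ENNReal.ofReal (Real.exp c) ≤
      ∑ i, curveLength h (γ i) 0 1 := by
    rw [Finset.sum_mul]
    exact Finset.sum_le_sum fun i _ => hL (γ i)
  calc _ = (ENNReal.ofReal (Real.exp (1 / α * d)))⁻¹ *
        (min (area h₀ S₁) (area h₀ S₂) ^ (1 / α))⁻¹ *
        ((∑ i, curveLength h₀ (γ i) 0 1) * ENNReal.ofReal (Real.exp c)) := by ring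
    _ ≤ _ := by gcongr

theorem le_mul_exp_of_mul_exp_neg_le {a b : ℝ≥0∞} {c : ℝ}
    (h : a * ENNReal.ofReal (Real.exp (-c)) ≤ b) : a ≤ b * ENNReal.ofReal (Real.exp c) := by
  refine le_trans (le_of_eq ?_) (mul_le_mul_left h _)
  rw [mul_assoc, ← ENNReal.ofReal_mul (Real.exp_pos _).le, ← Real.exp_add]
  simp

end Scaling

end IMCF

theorem mainTheorem8
    {M : Type*} [TopologicalSpace M] [T2Space M] [ChartedSpace IMCF.E3 M]
    [IsManifold 𝓘(ℝ, IMCF.E3) ∞ M]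
    {S : Type*} [TopologicalSpace S] [T2Space S] [CompactSpace S] [ChartedSpace IMCF.E2 S]
    [IsManifold 𝓘(ℝ, IMCF.E2) ∞ S] [MeasurableSpace S] [BorelSpace S]
    (g : IMCF.Metric3 M) (T H₀ A₀ : ℝ) (F : ℝ → S → M)
    (ν : ∀ (t : ℝ) (p : S), TangentSpace 𝓘(ℝ, IMCF.E3) (F t p))
    (hF : IMCF.IsSolution g T F ν)
    (hH₀ : 0 < H₀)
    (hH : ∀ t ∈ Set.Icc 0 T, ∀ p, H₀ ≤ IMCF.meanCurvature g (F t) p (ν t p))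
    (hA : ∀ t ∈ Set.Icc 0 T, ∀ p, IMCF.normA g (F t) p (ν t p) ≤ A₀) :
    -- lengths of curves, in particular of smooth simple closed curves
    (∀ t ∈ Set.Icc 0 T, ∀ γ : ℝ → S, ContMDiff 𝓘(ℝ, ℝ) 𝓘(ℝ, IMCF.E2) ∞ γ → ∀ a b : ℝ,
      IMCF.curveLength (IMCF.inducedMetric g (F 0)) γ a b
          * ENNReal.ofReal (Real.exp (-(2 * A₀ / H₀) * t))
        ≤ IMCF.curveLength (IMCF.inducedMetric g (F t)) γ a b ∧
      IMCF.curveLength (IMCF.inducedMetric g (F t)) γ a b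
        ≤ IMCF.curveLength (IMCF.inducedMetric g (F 0)) γ a b
          * ENNReal.ofReal (Real.exp ((2 * A₀ / H₀) * t))) ∧
    -- the Neumann isoperimetric constants
    (∀ α : ℝ, 0 < α → ∀ t ∈ Set.Icc 0 T,
      (IMCF.neumannIsoperimetric α (IMCF.inducedMetric g (F 0))
          * ENNReal.ofReal (Real.exp ((-(2 * A₀ / H₀) - 1 / α) * t))
        ≤ IMCF.neumannIsoperimetric α (IMCF.inducedMetric g (F t)) ∧
      IMCF.neumannIsoperimetric α (IMCF.inducedMetric g (F t))
        ≤ IMCF.neumannIsoperimetric α (IMCF.inducedMetric g (F 0))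
          * ENNReal.ofReal (Real.exp (((2 * A₀ / H₀) - 1 / α) * t))) ∧
      (IMCF.neumannIsoperimetricConn α (IMCF.inducedMetric g (F 0))
          * ENNReal.ofReal (Real.exp ((-(2 * A₀ / H₀) - 1 / α) * t))
        ≤ IMCF.neumannIsoperimetricConn α (IMCF.inducedMetric g (F t)) ∧
      IMCF.neumannIsoperimetricConn α (IMCF.inducedMetric g (F t))
        ≤ IMCF.neumannIsoperimetricConn α (IMCF.inducedMetric g (F 0))
          * ENNReal.ofReal (Real.exp (((2 * A₀ / H₀) - 1 / α) * t)))) := by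
  -- `0 ≤ A₀` because `|A|` is a square root; this needs a point of `S`, as an empty surface puts no
  -- condition on `A₀`
  have hk : ∀ t ∈ Set.Icc 0 T, ∀ _ : S, -(2 * A₀ / H₀) * t ≤ 0 := fun t ht p => by
    have hA₀ : 0 ≤ A₀ := (Real.sqrt_nonneg _).trans (hA t ht p)
    have := mul_nonneg (div_nonneg (mul_nonneg two_pos.le hA₀) hH₀.le) ht.1
    linarith
  have hbounds := fun p X t ht => IMCF.inducedMetric_self_bounds hF hH₀ hH hA p X (t := t) ht
  have hlow : ∀ t ∈ Set.Icc 0 T, ∀ (γ : ℝ → S) (a b : ℝ),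
      IMCF.curveLength (IMCF.inducedMetric g (F 0)) γ a b
          * ENNReal.ofReal (Real.exp (-(2 * A₀ / H₀) * t))
        ≤ IMCF.curveLength (IMCF.inducedMetric g (F t)) γ a b := fun t ht =>
    IMCF.curveLength_mul_exp_le (IMCF.inducedMetric_self_nonneg g (F 0)) (hk t ht)
      fun p X => (hbounds p X t ht).1
  have hupp : ∀ t ∈ Set.Icc 0 T, ∀ (γ : ℝ → S) (a b : ℝ),
      IMCF.curveLength (IMCF.inducedMetric g (F t)) γ a b
          * ENNReal.ofReal (Real.exp (-(2 * A₀ / H₀) * t))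
        ≤ IMCF.curveLength (IMCF.inducedMetric g (F 0)) γ a b := fun t ht =>
    IMCF.curveLength_mul_exp_le (IMCF.inducedMetric_self_nonneg g (F t)) (hk t ht) fun p X => by
      rw [neg_mul, Real.exp_neg, ← div_eq_mul_inv, div_le_iff₀ (Real.exp_pos _)]
      exact (hbounds p X t ht).2
  have harea : ∀ t ∈ Set.Icc 0 T, IMCF.area (IMCF.inducedMetric g (F t)) =
      ENNReal.ofReal (Real.exp t) • IMCF.area (IMCF.inducedMetric g (F 0)) := fun t ht =>
    IMCF.area_eq_smul fun x y => by
      rw [IMCF.det_gram_inducedMetric, IMCF.det_gram_inducedMetric,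
        IMCF.det_firstFundamentalForm_eq hF ht, mul_assoc]
  have harea' : ∀ t ∈ Set.Icc 0 T, IMCF.area (IMCF.inducedMetric g (F 0)) =
      ENNReal.ofReal (Real.exp (-t)) • IMCF.area (IMCF.inducedMetric g (F t)) := fun t ht => by
    rw [harea t ht, smul_smul, ← ENNReal.ofReal_mul (Real.exp_pos _).le, ← Real.exp_add]
    simp
  have hinf : ∀ (k : ℕ) (α : ℝ), 0 < α → ∀ t ∈ Set.Icc 0 T,
      IMCF.isoperimetricInf k α (IMCF.inducedMetric g (F 0))
          * ENNReal.ofReal (Real.exp ((-(2 * A₀ / H₀) - 1 / α) * t))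
        ≤ IMCF.isoperimetricInf k α (IMCF.inducedMetric g (F t)) ∧
      IMCF.isoperimetricInf k α (IMCF.inducedMetric g (F t))
        ≤ IMCF.isoperimetricInf k α (IMCF.inducedMetric g (F 0))
          * ENNReal.ofReal (Real.exp (((2 * A₀ / H₀) - 1 / α) * t)) := by
    intro k α hα t ht
    constructor
    · rw [sub_mul]
      exact IMCF.isoperimetricInf_mul_exp_le (fun γ => hlow t ht γ 0 1) (harea t ht) k hα
    · refine IMCF.le_mul_exp_of_mul_exp_neg_le ?_
      have h := IMCF.isoperimetricInf_mul_exp_le (fun γ => hupp t ht γ 0 1) (harea' t ht) k hα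
      convert h using 4
      ring
  refine ⟨fun t ht γ _ a b => ⟨hlow t ht γ a b, IMCF.le_mul_exp_of_mul_exp_neg_le ?_⟩,
    fun α hα t ht => ⟨⟨?_, ?_⟩, hinf 1 α hα t ht⟩⟩
  · rw [← neg_mul]
    exact hupp t ht γ a b
  · exact le_iInf fun k => (mul_le_mul_left (iInf_le _ k) _).trans (hinf k α hα t ht).1
  · -- the factor is positive and finite, so it can be moved to the other side of the infimum
    refine IMCF.le_mul_exp_of_mul_exp_neg_le (le_iInf fun k => ?_)
    refine (mul_le_mul_left ((iInf_le _ k).trans (hinf k α hα t ht).2) _).trans (le_of_eq ?_)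
    rw [mul_assoc, ← ENNReal.ofReal_mul (Real.exp_pos _).le, ← Real.exp_add]
    simp
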